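/- Let $d\in\mathbb{N}$ and let $\Lambda=\prod_{j=1}^d (l_j,r_j)\subset\mathbb{R}^d$ be a generalized rectangle, where $l_j,r_j\in\mathbb{R}\cup\{\pm\infty\}$ and $l_j<r_j$ for every $j$. A measurable function $W\colon\Lambda\to\mathbb{R}$ is called admissible (on $\Lambda$) if the domain $\mathcal{D}(W)=\{\psi\in L^2(\Lambda) : W\psi\in L^2(\Lambda)\}$ of the multiplication operator by $W$ in the complex Hilbert space $L^2(\Lambda)$ contains the Sobolev space $H^1(\Lambda)$. Let $V\colon\Lambda\to\mathbb{R}$ be measurable and assume that $V^2$ is admissible. Then $V$ is admissible, and there are $a,b\ge 0$ (depending only on $\Lambda$ and $V$) such that for every $\varepsilon>0$ the inequality \[ \|V\psi\|_{L^2(\Lambda)}^2\le \lambda_1\|\nabla\psi\|_{L^2(\Lambda)}^2+\lambda_2\|\psi\|_{L^2(\Lambda)}^2,\qquad \psi\in H^1(\Lambda), \] holds with $\lambda_1=a\varepsilon$ and $\lambda_2=a/\varepsilon+b$. -/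

import Mathlib

open MeasureTheory TopologicalSpace Set
open scoped Distributions ENNReal ContDiff

noncomputable section

namespace AdmissiblePotential

/-- The generalized rectangle `∏ⱼ (aⱼ, bⱼ)` in `ℝᵈ`, with endpoints `aⱼ, bⱼ ∈ ℝ ∪ {±∞}`. -/
def genRect {d : ℕ} (a b : Fin d → EReal) : Opens (EuclideanSpace ℝ (Fin d)) where
  carrier := {x | ∀ j, a j < (x j : EReal) ∧ (x j : EReal) < b j}
  is_open' := by
    simp only [ofPred_forall]
    refine isOpen_iInter_of_finite fun j => ?_
    have hc : Continuous fun x : EuclideanSpace ℝ (Fin d) => (x j : EReal) :=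
      continuous_coe_real_ereal.comp (by fun_prop)
    exact (isOpen_lt continuous_const hc).inter (isOpen_lt hc continuous_const)

/-- Lebesgue measure on an open subset of `ℝᵈ`. -/
instance instMeasureSpaceOpens {d : ℕ} (Λ : Opens (EuclideanSpace ℝ (Fin d))) : MeasureSpace Λ where
  volume := Measure.comap Subtype.val volume

/-- The complex Hilbert space `L²(Λ)` with respect to Lebesgue measure on `Λ`. -/
abbrev L2 {d : ℕ} (Λ : Opens (EuclideanSpace ℝ (Fin d))) : Type :=
  Lp ℂ 2 (volume : Measure Λ)

/-- The Hilbert space `L²(Λ; ℂᵈ)` of square integrable vector fields, with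
`‖g‖² = ∫_Λ ∑ⱼ |gⱼ|²`. -/
abbrev L2Vec {d : ℕ} (Λ : Opens (EuclideanSpace ℝ (Fin d))) : Type :=
  Lp (EuclideanSpace ℂ (Fin d)) 2 (volume : Measure Λ)

/-- `HasWeakGradient ψ g`: the vector field `g ∈ L²(Λ; ℂᵈ)` is the weak gradient `∇ψ` of
`ψ ∈ L²(Λ)`, i.e. `∫_Λ ψ ∂ⱼφ = - ∫_Λ gⱼ φ` for every `j` and every test function
`φ ∈ C_c^∞(Λ)`. -/
def HasWeakGradient {d : ℕ} {Λ : Opens (EuclideanSpace ℝ (Fin d))} (ψ : L2 Λ) (g : L2Vec Λ) :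
    Prop :=
  ∀ (φ : 𝓓(Λ, ℝ)) (j : Fin d),
    ∫ x : Λ, fderiv ℝ φ x (EuclideanSpace.single j 1) • ψ x = - ∫ x : Λ, φ x • (g x) j

theorem integrable_smul_of_hasCompactSupport {d : ℕ} {Λ : Opens (EuclideanSpace ℝ (Fin d))}
    {f : EuclideanSpace ℝ (Fin d) → ℝ} (hf : Continuous f) (hs : HasCompactSupport f)
    {u : Λ → ℂ} (hu : MemLp u 2 volume) : Integrable (fun x : Λ => f x • u x) volume := by
  have h1 : MemLp f 2 ((volume : Measure (EuclideanSpace ℝ (Fin d))).restrict Λ) :=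
    (hf.memLp_of_hasCompactSupport hs).restrict _
  have h2 : MemLp (fun x : Λ => f x) 2 volume :=
    h1.comp_measurePreserving (measurePreserving_subtype_coe Λ.isOpen.measurableSet)
  exact memLp_one_iff_integrable.1 (hu.smul h2)

theorem integrable_test_smul {d : ℕ} {Λ : Opens (EuclideanSpace ℝ (Fin d))} (φ : 𝓓(Λ, ℝ))
    (j : Fin d) (g : L2Vec Λ) : Integrable (fun x : Λ => φ x • (g x) j) volume :=
  integrable_smul_of_hasCompactSupport φ.continuous φ.hasCompactSupport
    ((EuclideanSpace.proj j : EuclideanSpace ℂ (Fin d) →L[ℂ] ℂ).comp_memLp' (Lp.memLp g))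

theorem integrable_fderiv_test_smul {d : ℕ} {Λ : Opens (EuclideanSpace ℝ (Fin d))}
    (φ : 𝓓(Λ, ℝ)) (j : Fin d) (ψ : L2 Λ) :
    Integrable (fun x : Λ => fderiv ℝ φ x (EuclideanSpace.single j 1) • ψ x) volume :=
  integrable_smul_of_hasCompactSupport
    (f := fun x => fderiv ℝ φ x (EuclideanSpace.single j 1))
    ((φ.contDiff.continuous_fderiv (by simp)).clm_apply continuous_const)
    (φ.hasCompactSupport.fderiv_apply ℝ _) (Lp.memLp ψ)

theorem HasWeakGradient.add {d : ℕ} {Λ : Opens (EuclideanSpace ℝ (Fin d))} {ψ₁ ψ₂ : L2 Λ}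
    {g₁ g₂ : L2Vec Λ} (h₁ : HasWeakGradient ψ₁ g₁) (h₂ : HasWeakGradient ψ₂ g₂) :
    HasWeakGradient (ψ₁ + ψ₂) (g₁ + g₂) := by
  intro φ j
  have e₁ : ∫ x : Λ, fderiv ℝ φ x (EuclideanSpace.single j 1) • (ψ₁ + ψ₂ : L2 Λ) x
      = ∫ x : Λ, (fderiv ℝ φ x (EuclideanSpace.single j 1) • ψ₁ x
        + fderiv ℝ φ x (EuclideanSpace.single j 1) • ψ₂ x) := by
    refine integral_congr_ae ?_
    filter_upwards [Lp.coeFn_add ψ₁ ψ₂] with x hx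
    rw [hx, Pi.add_apply, smul_add]
  have e₂ : ∫ x : Λ, φ x • ((g₁ + g₂ : L2Vec Λ) x) j
      = ∫ x : Λ, (φ x • (g₁ x) j + φ x • (g₂ x) j) := by
    refine integral_congr_ae ?_
    filter_upwards [Lp.coeFn_add g₁ g₂] with x hx
    rw [hx, Pi.add_apply, PiLp.add_apply, smul_add]
  rw [e₁, e₂, integral_add (integrable_fderiv_test_smul φ j ψ₁)
    (integrable_fderiv_test_smul φ j ψ₂), integral_add (integrable_test_smul φ j g₁)
    (integrable_test_smul φ j g₂), h₁ φ j, h₂ φ j]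
  ring

theorem HasWeakGradient.smul {d : ℕ} {Λ : Opens (EuclideanSpace ℝ (Fin d))} {ψ : L2 Λ}
    {g : L2Vec Λ} (c : ℂ) (h : HasWeakGradient ψ g) : HasWeakGradient (c • ψ) (c • g) := by
  intro φ j
  have e₁ : ∫ x : Λ, fderiv ℝ φ x (EuclideanSpace.single j 1) • (c • ψ : L2 Λ) x
      = ∫ x : Λ, c • (fderiv ℝ φ x (EuclideanSpace.single j 1) • ψ x) := by
    refine integral_congr_ae ?_
    filter_upwards [Lp.coeFn_smul c ψ] with x hx
    rw [hx, Pi.smul_apply, smul_comm]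
  have e₂ : ∫ x : Λ, φ x • ((c • g : L2Vec Λ) x) j = ∫ x : Λ, c • (φ x • (g x) j) := by
    refine integral_congr_ae ?_
    filter_upwards [Lp.coeFn_smul c g] with x hx
    rw [hx, Pi.smul_apply, PiLp.smul_apply, smul_comm]
  rw [e₁, e₂, integral_smul, integral_smul, h φ j, smul_neg]

theorem hasWeakGradient_zero {d : ℕ} {Λ : Opens (EuclideanSpace ℝ (Fin d))} :
    HasWeakGradient (0 : L2 Λ) 0 := by
  intro φ j
  have e₁ : ∫ x : Λ, fderiv ℝ φ x (EuclideanSpace.single j 1) • (0 : L2 Λ) x = 0 := by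
    refine integral_eq_zero_of_ae ?_
    filter_upwards [Lp.coeFn_zero ℂ 2 (volume : Measure Λ)] with x hx
    simp only [hx, Pi.zero_apply, smul_zero]
  have e₂ : ∫ x : Λ, φ x • ((0 : L2Vec Λ) x) j = 0 := by
    refine integral_eq_zero_of_ae ?_
    filter_upwards [Lp.coeFn_zero (EuclideanSpace ℂ (Fin d)) 2 (volume : Measure Λ)] with x hx
    simp only [hx, Pi.zero_apply, PiLp.zero_apply, smul_zero]
  rw [e₁, e₂, neg_zero]

/-- The Sobolev space `H¹(Λ)`: all `ψ ∈ L²(Λ)` with a weak gradient in `L²(Λ; ℂᵈ)`. -/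
def H1 {d : ℕ} (Λ : Opens (EuclideanSpace ℝ (Fin d))) : Submodule ℂ (L2 Λ) where
  carrier := {ψ | ∃ g : L2Vec Λ, HasWeakGradient ψ g}
  add_mem' := fun ⟨g₁, h₁⟩ ⟨g₂, h₂⟩ => ⟨g₁ + g₂, h₁.add h₂⟩
  zero_mem' := ⟨0, hasWeakGradient_zero⟩
  smul_mem' := fun c _ ⟨g, h⟩ => ⟨c • g, h.smul c⟩

/-- The domain `𝒟(V) = {ψ ∈ L²(Λ) | Vψ ∈ L²(Λ)}` of the multiplication operator by `V`. -/
def mulDomain {d : ℕ} {Λ : Opens (EuclideanSpace ℝ (Fin d))} (V : Λ → ℝ) :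
    Submodule ℂ (L2 Λ) where
  carrier := {ψ | MemLp (fun x => (V x : ℂ) * ψ x) 2 volume}
  add_mem' := fun {ψ₁ ψ₂} h₁ h₂ => (MemLp.add h₁ h₂).ae_eq (by
    filter_upwards [Lp.coeFn_add ψ₁ ψ₂] with x hx
    rw [hx, Pi.add_apply, Pi.add_apply, mul_add])
  zero_mem' := (MemLp.zero' (ε := ℂ)).ae_eq (by
    filter_upwards [Lp.coeFn_zero ℂ 2 (volume : Measure Λ)] with x hx
    rw [hx, Pi.zero_apply, mul_zero])
  smul_mem' := fun c ψ h => (MemLp.const_smul h c).ae_eq (by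
    filter_upwards [Lp.coeFn_smul c ψ] with x hx
    rw [hx, Pi.smul_apply, Pi.smul_apply, mul_smul_comm])

theorem memLp_of_mem_mulDomain {d : ℕ} {Λ : Opens (EuclideanSpace ℝ (Fin d))} {V : Λ → ℝ}
    {ψ : L2 Λ} (h : ψ ∈ mulDomain V) : MemLp (fun x => (V x : ℂ) * ψ x) 2 volume := h

/-- The maximal multiplication operator `ψ ↦ Vψ` in `L²(Λ)`. -/
def mulOp {d : ℕ} {Λ : Opens (EuclideanSpace ℝ (Fin d))} (V : Λ → ℝ) : L2 Λ →ₗ.[ℂ] L2 Λ where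
  domain := mulDomain V
  toFun :=
    { toFun := fun ψ => MemLp.toLp (fun x => (V x : ℂ) * (ψ : L2 Λ) x) (memLp_of_mem_mulDomain ψ.2)
      map_add' := fun ψ₁ ψ₂ => by
        rw [← MemLp.toLp_add]
        refine MemLp.toLp_congr _ _ ?_
        filter_upwards [Lp.coeFn_add (ψ₁ : L2 Λ) ψ₂] with x hx
        rw [Submodule.coe_add, hx, Pi.add_apply, Pi.add_apply, mul_add]
      map_smul' := fun c ψ => by
        rw [RingHom.id_apply, ← MemLp.toLp_const_smul]
        refine MemLp.toLp_congr _ _ ?_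
        filter_upwards [Lp.coeFn_smul c (ψ : L2 Λ)] with x hx
        rw [Submodule.coe_smul, hx, Pi.smul_apply, Pi.smul_apply, mul_smul_comm] }

/-- `V : Λ → ℝ` is admissible on `Λ` if it is measurable and `𝒟(V) ⊇ H¹(Λ)`. -/
def Admissible {d : ℕ} {Λ : Opens (EuclideanSpace ℝ (Fin d))} (V : Λ → ℝ) : Prop :=
  Measurable V ∧ H1 Λ ≤ (mulOp V).domain

/-- The constants `lam₁, lam₂ ≥ 0` are as in the form bound of an admissible potential `V`:
`‖Vψ‖² ≤ lam₁ ‖∇ψ‖² + lam₂ ‖ψ‖²` for all `ψ ∈ H¹(Λ)`. -/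
def IsFormBound {d : ℕ} {Λ : Opens (EuclideanSpace ℝ (Fin d))} {V : Λ → ℝ} (hV : Admissible V)
    (lam₁ lam₂ : ℝ) : Prop :=
  0 ≤ lam₁ ∧ 0 ≤ lam₂ ∧ ∀ (ψ : H1 Λ) (g : L2Vec Λ), HasWeakGradient (ψ : L2 Λ) g →
    ‖mulOp V ⟨ψ, hV.2 ψ.2⟩‖ ^ 2 ≤ lam₁ * ‖g‖ ^ 2 + lam₂ * ‖(ψ : L2 Λ)‖ ^ 2

end AdmissiblePotential

end

namespace AdmissiblePotential

open Filter Topology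

variable {d : ℕ} {Λ : Opens (EuclideanSpace ℝ (Fin d))}

/-! Two facts carry the proof. Since `V` is real, `‖Vψ‖² = ⟨V²ψ, ψ⟩ ≤ ‖V²ψ‖ ‖ψ‖`; the same pointwise
identity gives `𝒟(V²) ⊆ 𝒟(V)`, hence admissibility. By the closed graph theorem, an admissible `W`
satisfies `‖Wψ‖ ≤ C (‖∇ψ‖ + ‖ψ‖)` on `H¹(Λ)`. With `W = V²` this yields `‖Vψ‖² ≤ C (‖∇ψ‖ ‖ψ‖ +
‖ψ‖²)`, and Young's inequality with weight `ε` splits the mixed term. The rectangular shape of `Λ`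
plays no role. -/

/-- Integration of an `L²` function against a fixed continuous, compactly supported function is
continuous on `L²(Λ)`. -/
theorem continuous_integral_smul {f : EuclideanSpace ℝ (Fin d) → ℝ} (hf : Continuous f)
    (hs : HasCompactSupport f) : Continuous fun u : L2 Λ => ∫ x : Λ, f x • u x := by
  have h1 : MemLp f 2 ((volume : Measure (EuclideanSpace ℝ (Fin d))).restrict Λ) :=
    (hf.memLp_of_hasCompactSupport hs).restrict _
  have h2 : MemLp (fun x : Λ => (f x : ℂ)) 2 volume :=
    (h1.comp_measurePreserving (measurePreserving_subtype_coe Λ.isOpen.measurableSet)).ofReal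
  have h3 : (fun u : L2 Λ => ∫ x : Λ, f x • u x) = fun u => inner ℂ (h2.toLp _) u := by
    funext u
    rw [L2.inner_def]
    refine integral_congr_ae ?_
    filter_upwards [h2.coeFn_toLp] with x hx
    rw [hx, RCLike.inner_apply, Complex.conj_ofReal, Complex.real_smul, mul_comm]
  rw [h3]
  exact continuous_const.inner continuous_id

/-- The coordinate map `L²(Λ; ℂᵈ) → L²(Λ)`. -/
noncomputable def coordL2 (Λ : Opens (EuclideanSpace ℝ (Fin d))) (j : Fin d) : L2Vec Λ →L[ℂ] L2 Λ :=
  (EuclideanSpace.proj j : EuclideanSpace ℂ (Fin d) →L[ℂ] ℂ).compLpL 2 volume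

theorem integral_smul_coordL2 (φ : Λ → ℝ) (j : Fin d) (g : L2Vec Λ) :
    ∫ x : Λ, φ x • coordL2 Λ j g x = ∫ x : Λ, φ x • (g x) j := by
  refine integral_congr_ae ?_
  filter_upwards [(EuclideanSpace.proj j : EuclideanSpace ℂ (Fin d) →L[ℂ] ℂ).coeFn_compLpL
    (p := 2) g] with x hx
  rw [coordL2, hx]
  rfl

/-- The graph of the weak gradient, as a subspace of `L²(Λ) × L²(Λ; ℂᵈ)`. -/
def weakGradientGraph (Λ : Opens (EuclideanSpace ℝ (Fin d))) : Submodule ℂ (L2 Λ × L2Vec Λ) where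
  carrier := {p | HasWeakGradient p.1 p.2}
  add_mem' := fun h₁ h₂ => HasWeakGradient.add h₁ h₂
  zero_mem' := hasWeakGradient_zero
  smul_mem' := fun c _ h => HasWeakGradient.smul c h

/-- Each test function and coordinate imposes an equation between two continuous functions of the
pair, so the graph is an intersection of closed sets. This makes `H¹(Λ)` complete in the graph norm.
-/
theorem isClosed_weakGradientGraph :
    IsClosed (weakGradientGraph Λ : Set (L2 Λ × L2Vec Λ)) := by
  have h : (weakGradientGraph Λ : Set (L2 Λ × L2Vec Λ)) = {p | HasWeakGradient p.1 p.2} := rfl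
  rw [h]
  simp only [HasWeakGradient, Set.ofPred_forall]
  refine isClosed_iInter fun φ => isClosed_iInter fun j => isClosed_eq ?_ ?_
  · exact (continuous_integral_smul
      (f := fun x => fderiv ℝ φ x (EuclideanSpace.single j 1))
      ((φ.contDiff.continuous_fderiv (by simp)).clm_apply continuous_const)
      (φ.hasCompactSupport.fderiv_apply ℝ _)).comp continuous_fst
  · simp only [← integral_smul_coordL2]
    exact ((continuous_integral_smul φ.continuous φ.hasCompactSupport).comp
      ((coordL2 Λ j).continuous.comp continuous_snd)).neg

/-- The multiplication operator by a real function is closed. -/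
theorem mulOp_eq_of_tendsto {W : Λ → ℝ} {u : ℕ → (mulOp W).domain} {ψ : (mulOp W).domain}
    {h : L2 Λ} (hu : Tendsto (fun n => (u n : L2 Λ)) atTop (𝓝 (ψ : L2 Λ)))
    (hW : Tendsto (fun n => mulOp W (u n)) atTop (𝓝 h)) : h = mulOp W ψ := by
  -- Both convergences must hold almost everywhere along one subsequence, so the second is extracted
  -- from the first.
  obtain ⟨s, hs, hs'⟩ := (tendstoInMeasure_of_tendsto_Lp hu).exists_seq_tendsto_ae
  obtain ⟨t, ht, ht'⟩ :=
    (tendstoInMeasure_of_tendsto_Lp (hW.comp hs.tendsto_atTop)).exists_seq_tendsto_ae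
  have hmul (χ : (mulOp W).domain) : ∀ᵐ x, mulOp W χ x = (W x : ℂ) * (χ : L2 Λ) x :=
    MemLp.coeFn_toLp (memLp_of_mem_mulDomain χ.2)
  refine Lp.ext ?_
  filter_upwards [hs', ht', hmul ψ, ae_all_iff.2 fun n => hmul (u n)] with x hx hx' hψ hn
  refine tendsto_nhds_unique hx' ?_
  simp only [Function.comp_apply, hn, hψ]
  exact (hx.comp ht.tendsto_atTop).const_mul _

/-- Multiplication by an admissible potential is bounded from `H¹(Λ)` to `L²(Λ)`. -/
theorem Admissible.exists_bound {W : Λ → ℝ} (hW : Admissible W) :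
    ∃ C : ℝ, 0 ≤ C ∧ ∀ (ψ : H1 Λ) (g : L2Vec Λ), HasWeakGradient (ψ : L2 Λ) g →
      ‖mulOp W ⟨ψ, hW.2 ψ.2⟩‖ ≤ C * (‖g‖ + ‖(ψ : L2 Λ)‖) := by
  have : CompleteSpace (weakGradientGraph Λ) :=
    isClosed_weakGradientGraph.completeSpace_coe
  let ι : weakGradientGraph Λ →ₗ[ℂ] (mulOp W).domain :=
    ((LinearMap.fst ℂ (L2 Λ) (L2Vec Λ)).comp (weakGradientGraph Λ).subtype).codRestrict _
      fun p => hW.2 ⟨p.1.2, p.2⟩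
  -- The closed graph theorem applies to `(ψ, g) ↦ Wψ`: convergence in the graph forces `ψ` to
  -- converge in `L²`, and multiplication by `W` is closed.
  let T : weakGradientGraph Λ →L[ℂ] L2 Λ :=
    ContinuousLinearMap.ofSeqClosedGraph (g := (mulOp W).toFun.comp ι) fun u p h hu hTu =>
      mulOp_eq_of_tendsto (u := fun n => ι (u n)) (ψ := ι p)
        (((continuous_fst.comp continuous_subtype_val).tendsto p).comp hu) hTu
  refine ⟨‖T‖, T.opNorm_nonneg, fun ψ g hg => ?_⟩
  refine (T.le_opNorm ⟨((ψ : L2 Λ), g), hg⟩).trans ?_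
  refine mul_le_mul_of_nonneg_left ?_ T.opNorm_nonneg
  -- The product norm is the maximum of the two norms, hence at most their sum.
  refine max_le ?_ ?_
  · exact le_add_of_nonneg_left (norm_nonneg _)
  · exact le_add_of_nonneg_right (norm_nonneg _)

/-- `𝒟(V²) ⊆ 𝒟(V)` for the multiplication operators by a measurable function. -/
theorem mulDomain_sq_le {V : Λ → ℝ} (hV : Measurable V) :
    mulDomain (fun x => V x ^ 2) ≤ mulDomain V := by
  intro ψ h
  have h' : MemLp (fun x => ((V x ^ 2 : ℝ) : ℂ) * ψ x) 2 volume := h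
  have hsm : AEStronglyMeasurable (fun x => (V x : ℂ) * ψ x) volume :=
    (Complex.measurable_ofReal.comp hV).aestronglyMeasurable.mul (Lp.aestronglyMeasurable ψ)
  refine (memLp_two_iff_integrable_sq_norm hsm).2 ?_
  -- `|Vψ|² = |V²ψ| |ψ|` is a product of two `L²` functions.
  refine (h'.norm.integrable_mul (Lp.memLp ψ).norm).congr (Eventually.of_forall fun x => ?_)
  simp only [Pi.mul_apply, norm_mul, Complex.norm_real, norm_pow]
  ring

/-- `‖Vψ‖² ≤ ‖V²ψ‖ ‖ψ‖`. -/
theorem norm_mulOp_sq_le {V : Λ → ℝ} {ψ : L2 Λ} (h₁ : ψ ∈ (mulOp V).domain)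
    (h₂ : ψ ∈ (mulOp fun x => V x ^ 2).domain) :
    ‖mulOp V ⟨ψ, h₁⟩‖ ^ 2 ≤ ‖mulOp (fun x => V x ^ 2) ⟨ψ, h₂⟩‖ * ‖ψ‖ := by
  have e : inner ℂ (mulOp V ⟨ψ, h₁⟩) (mulOp V ⟨ψ, h₁⟩)
      = inner ℂ (mulOp (fun x => V x ^ 2) ⟨ψ, h₂⟩) ψ := by
    rw [L2.inner_def, L2.inner_def]
    refine integral_congr_ae ?_
    filter_upwards [MemLp.coeFn_toLp (memLp_of_mem_mulDomain h₁),
      MemLp.coeFn_toLp (memLp_of_mem_mulDomain h₂)] with x hx₁ hx₂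
    have hx₁' : mulOp V ⟨ψ, h₁⟩ x = (V x : ℂ) * ψ x := hx₁
    have hx₂' : mulOp (fun x => V x ^ 2) ⟨ψ, h₂⟩ x = ((V x ^ 2 : ℝ) : ℂ) * ψ x := hx₂
    rw [hx₁', hx₂']
    simp only [RCLike.inner_apply, map_mul, map_pow, Complex.conj_ofReal, Complex.ofReal_pow]
    ring
  calc ‖mulOp V ⟨ψ, h₁⟩‖ ^ 2 = ‖inner ℂ (mulOp V ⟨ψ, h₁⟩) (mulOp V ⟨ψ, h₁⟩)‖ := by
        rw [inner_self_eq_norm_sq_to_K, norm_pow, RCLike.norm_ofReal, abs_norm]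
    _ ≤ ‖mulOp (fun x => V x ^ 2) ⟨ψ, h₂⟩‖ * ‖ψ‖ := e ▸ norm_inner_le_norm _ _

end AdmissiblePotential

theorem mainTheorem6 {d : ℕ} (l r : Fin d → EReal) (hlr : ∀ j, l j < r j)
    (V : AdmissiblePotential.genRect l r → ℝ) (hV : Measurable V)
    (hV2 : AdmissiblePotential.Admissible (fun x => V x ^ 2)) :
    ∃ hadm : AdmissiblePotential.Admissible V,
      ∃ a b : ℝ, 0 ≤ a ∧ 0 ≤ b ∧
        ∀ ε : ℝ, 0 < ε → AdmissiblePotential.IsFormBound hadm (a * ε) (a / ε + b) := by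
  have hadm : AdmissiblePotential.Admissible V :=
    ⟨hV, hV2.2.trans (AdmissiblePotential.mulDomain_sq_le hV)⟩
  obtain ⟨C, hC, hbound⟩ := hV2.exists_bound
  -- `a = b = C`, the closed graph constant of `V²`, which is independent of `ε`.
  refine ⟨hadm, C, C, hC, hC, fun ε hε => ⟨by positivity, by positivity, fun ψ g hg => ?_⟩⟩
  refine (AdmissiblePotential.norm_mulOp_sq_le _ (hV2.2 ψ.2)).trans ?_
  refine (mul_le_mul_of_nonneg_right (hbound ψ g hg) (norm_nonneg _)).trans ?_
  generalize ‖g‖ = x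
  generalize ‖(ψ : AdmissiblePotential.L2 (AdmissiblePotential.genRect l r))‖ = y
  have key : x * y ≤ ε * x ^ 2 + y ^ 2 / ε := by
    -- Completing the square; the leftover `3y²` appears because `y²/(4ε)` would already suffice in
    -- place of `y²/ε`.
    have h : ε * x ^ 2 + y ^ 2 / ε - x * y = ((2 * ε * x - y) ^ 2 + 3 * y ^ 2) / (4 * ε) := by
      field_simp
      ring
    have : 0 ≤ ((2 * ε * x - y) ^ 2 + 3 * y ^ 2) / (4 * ε) := by positivity
    linarith
  calc C * (x + y) * y = C * (x * y) + C * y ^ 2 := by ring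
    _ ≤ C * (ε * x ^ 2 + y ^ 2 / ε) + C * y ^ 2 := by gcongr
    _ = C * ε * x ^ 2 + (C / ε + C) * y ^ 2 := by ring
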